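/- Let $d\in\mathbb{N}$, $d\ge 1$, $H\in(0,1)$ and $p,q\in[1,\infty)$ be such that $$\frac{1-H}{q}+\frac{Hd}{p}>1-H .$$ Then for every $x\in\mathbb{R}^d$ there exists a Borel function $b\colon[0,1]\times\mathbb{R}^d\to\mathbb{R}^d$ in $L_q([0,1],L_p(\mathbb{R}^d))$, that is, with $\int_0^1\|b_t\|_{L_p(\mathbb{R}^d)}^q\,dt<\infty$, such that the equation $$X_t=x+\int_0^t b_r(X_r)\,dr+W^H_t,\qquad t\in[0,1],\tag{1}$$ where $W^H$ is a $d$-dimensional fractional Brownian motion of Hurst parameter $H$, has no weak solution. Here a weak solution of (1) is a pair $(X,W^H)$ of $\mathbb{R}^d$-valued processes on a complete filtered probability space $(\Omega,\mathcal F,\mathbb F=(\mathcal F_t)_{t\in[0,1]},\mathbb P)$ such that $W^H$ is an $\mathbb F$-fractional Brownian motion of Hurst parameter $H$, $X$ is continuous and adapted to $\mathbb F$, and almost surely the function $r\mapsto b_r(X_r)$ is Lebesgue integrable on $[0,1]$ and (1) holds for all $t\in[0,1]$. An $\mathbb F$-fractional Brownian motion is a fractional Brownian motion $W^H$ (a continuous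 centered Gaussian process with independent coordinates, each of covariance $\frac12(s^{2H}+t^{2H}-|t-s|^{2H})$) for which there is a $d$-dimensional $\mathbb F$-Brownian motion $B$ with $W^H_t=\int_0^tK_H(t,s)\,dB_s$ for every $t\in[0,1]$, where for $0<s<t$ $$K_H(t,s)=C\,s^{\frac12-H}\int_s^t(r-s)^{H-\frac32}r^{H-\frac12}\,dr\quad\text{if }H>\tfrac12,$$ $$K_H(t,s)=C\Bigl(t^{H-\frac12}s^{\frac12-H}(t-s)^{H-\frac12}+\bigl(\tfrac12-H\bigr)s^{\frac12-H}\int_s^t(r-s)^{H-\frac12}r^{H-\frac32}\,dr\Bigr)\quad\text{if }H\le\tfrac12,$$ and $C>0$ is the normalizing constant. -/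

import Mathlib

universe u

noncomputable section

open MeasureTheory ProbabilityTheory Filter Topology unitInterval
open scoped ENNReal NNReal

namespace FractionalSDE

/-- Euclidean space `ℝ^d`. -/
abbrev E (d : ℕ) : Type := EuclideanSpace ℝ (Fin d)

/-- A Borel function `b : [0,1] × ℝ^d → ℝ^d` belongs to `L_q([0,1], L_p(ℝ^d))`, that is,
`∫_0^1 ‖b_t‖_{L_p(ℝ^d)}^q dt < ∞`. -/
def MemMixedLp {d : ℕ} (q p : ℝ) (b : I → E d → E d) : Prop :=
  Measurable (Function.uncurry b) ∧
    eLpNorm (fun t : I => eLpNorm (b t) (ENNReal.ofReal p) volume) (ENNReal.ofReal q) volume < ∞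

/-- The Volterra kernel `K_H(t, s)`, `0 < s < t`, of fractional Brownian motion of Hurst
parameter `H`, without its normalizing constant. -/
def volterraKernel (H t s : ℝ) : ℝ :=
  if 1 / 2 < H then
    s ^ (1 / 2 - H) * ∫ r in s..t, (r - s) ^ (H - 3 / 2) * r ^ (H - 1 / 2)
  else
    t ^ (H - 1 / 2) * s ^ (1 / 2 - H) * (t - s) ^ (H - 1 / 2) +
      (1 / 2 - H) * s ^ (1 / 2 - H) * ∫ r in s..t, (r - s) ^ (H - 1 / 2) * r ^ (H - 3 / 2)

/-- A step function `∑ k, c k * 𝟙_{(u k, v k]}` on `[0,1]`. -/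
structure StepFunction where
  n : ℕ
  c : Fin n → ℝ
  u : Fin n → I
  v : Fin n → I
  le : ∀ k, u k ≤ v k

/-- The value of a step function at a point. -/
def StepFunction.eval (φ : StepFunction) (s : I) : ℝ :=
  ∑ k, (Set.Ioc (φ.u k) (φ.v k)).indicator (fun _ => φ.c k) s

/-- The elementary integral `∫ φ dB = ∑ k, c k • (B (v k) - B (u k))`. -/
def StepFunction.integral {d : ℕ} {Ω : Type*} (φ : StepFunction) (B : I → Ω → E d) (ω : Ω) : E d :=
  ∑ k, φ.c k • (B (φ.v k) ω - B (φ.u k) ω)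

/-- `Y` is the Wiener integral `∫_0^1 g(s) dB_s` of the deterministic function `g`: the limit in
`L²(P)` of elementary integrals of step functions that converge to `g` in `L²([0,1])`. -/
def IsWienerIntegral {d : ℕ} {Ω : Type*} [MeasurableSpace Ω] (P : Measure Ω)
    (B : I → Ω → E d) (g : I → ℝ) (Y : Ω → E d) : Prop :=
  ∃ φ : ℕ → StepFunction,
    Tendsto (fun n => eLpNorm (fun s => (φ n).eval s - g s) 2 volume) atTop (𝓝 0) ∧
    Tendsto (fun n => eLpNorm (fun ω => (φ n).integral B ω - Y ω) 2 P) atTop (𝓝 0)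

/-- `B` is a standard `d`-dimensional Brownian motion on `[0,1]` relative to the filtration `F`. -/
structure IsBrownianMotion {d : ℕ} {Ω : Type*} {m : MeasurableSpace Ω} (P : Measure Ω)
    (F : Filtration I m) (B : I → Ω → E d) : Prop where
  adapted : Adapted F B
  zero : ∀ᵐ ω ∂P, B 0 ω = 0
  continuous : ∀ᵐ ω ∂P, Continuous fun t => B t ω
  law : ∀ s t : I, s ≤ t →
    HasLaw (fun ω => B t ω - B s ω)
      (multivariateGaussian (0 : E d) (((t : ℝ) - s) • (1 : Matrix (Fin d) (Fin d) ℝ))) P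
  indep : ∀ s t : I, s ≤ t →
    Indep (MeasurableSpace.comap (fun ω => B t ω - B s ω) inferInstance) (F s) P

/-- `W` is a `d`-dimensional fractional Brownian motion on `[0,1]` of Hurst parameter `H`: a
continuous centered Gaussian process with independent coordinates, each of covariance
`(s^{2H} + t^{2H} - |t - s|^{2H}) / 2`. -/
structure IsFBM {d : ℕ} {Ω : Type*} [MeasurableSpace Ω] (P : Measure Ω) (H : ℝ)
    (W : I → Ω → E d) : Prop where
  gaussian : IsGaussianProcess W P
  mean : ∀ t, P[W t] = 0
  cov : ∀ (s t : I) (i j : Fin d),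
    cov[fun ω => W s ω i, fun ω => W t ω j; P] =
      if i = j then
        ((s : ℝ) ^ (2 * H) + (t : ℝ) ^ (2 * H) - |(t : ℝ) - s| ^ (2 * H)) / 2
      else 0
  continuous : ∀ᵐ ω ∂P, Continuous fun t => W t ω

/-- `W` is an `F`-fractional Brownian motion: a fractional Brownian motion for which there is an
`F`-Brownian motion `B` with `W_t = ∫_0^t K_H(t,s) dB_s`. The constant `C` is the normalizing
constant of `K_H`; its value is determined by the covariance of `W`. -/
def IsAdaptedFBM {d : ℕ} {Ω : Type*} {m : MeasurableSpace Ω} (P : Measure Ω)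
    (F : Filtration I m) (H : ℝ) (W : I → Ω → E d) : Prop :=
  IsFBM P H W ∧
    ∃ B : I → Ω → E d, IsBrownianMotion P F B ∧ ∃ C : ℝ, 0 < C ∧ ∀ t : I,
      IsWienerIntegral P B
        ((Set.Iio t).indicator fun s : I => C * volterraKernel H (t : ℝ) (s : ℝ)) (W t)

/-- `(X, W)`, on the filtered probability space `(Ω, m, F, P)`, is a weak solution of
`X_t = x + ∫_0^t b_r(X_r) dr + W_t`, `t ∈ [0,1]`, the integral being a Lebesgue integral. -/
structure IsWeakSolution {d : ℕ} {Ω : Type*} {m : MeasurableSpace Ω} (P : Measure Ω)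
    (F : Filtration I m) (H : ℝ) (x : E d) (b : I → E d → E d) (X W : I → Ω → E d) : Prop where
  prob : IsProbabilityMeasure P
  /-- The space is complete: all null sets (outer measure zero) belong to every `F t`, hence
  to `m`. -/
  complete : ∀ (t : I) (N : Set Ω), P N = 0 → MeasurableSet[F t] N
  fbm : IsAdaptedFBM P F H W
  adapted : Adapted F X
  continuous : ∀ᵐ ω ∂P, Continuous fun t => X t ω
  equation : ∀ᵐ ω ∂P, Integrable (fun r : I => b r (X r ω)) volume ∧
    ∀ t : I, X t ω = x + (∫ r in Set.Iic t, b r (X r ω)) + W t ω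

/-- The equation has a weak solution on some complete filtered probability space. -/
def HasWeakSolution {d : ℕ} (H : ℝ) (x : E d) (b : I → E d → E d) : Prop :=
  ∃ (Ω : Type u) (m : MeasurableSpace Ω) (P : Measure Ω) (F : Filtration I m)
    (X W : I → Ω → E d), IsWeakSolution P F H x b X W

end FractionalSDE

end

noncomputable section

open MeasureTheory ProbabilityTheory Filter Topology unitInterval
open scoped ENNReal NNReal

/-! The drift is `-‖y‖^(-α) t^(-β) sign(y_i)` in each coordinate, on the unit ball around the
starting point, with `α < d/p` and `β < 1/q` so that it lies in the mixed space. It is so attractive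
that a solution stays too close to the starting point for its noise to oscillate as a fractional
Brownian motion must.

Fix a path and put `Y = X - x`. If the noise is `h`-Hölder with `h < H`, balancing the pull against
the noise on the last excursion of a coordinate before the maximum of `‖Y‖` gives `‖Y‖ ≤ C t^γ` on
`[0,t]` for small `t`, where `γ = βh/(1-h-αh)` (`norm_le_of_attractingDrift`). The condition on `p,
q` is what allows `γ > H/(1-H)` (`exists_exponents`).

Now take `m` steps of length `m^(-1/H)`, ending at `t_m = m^(1-1/H) → 0`. By the equation, the
variation of the noise along them is at most `2 m C t_m^γ` plus the integral of the drift's norm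
over `[0,t_m]`, and both vanish (`tendsto_sum_abs_sub`). But each noise increment is `1/m` times a
standard Gaussian in law, so the variation has constant positive mean and bounded second moment and
cannot tend to zero almost surely (`IsFBM.not_ae_tendsto_sum_abs_sub`). -/

namespace FractionalSDE

/-! ### Gaussian increments of fractional Brownian motion -/

section Increments

variable {d : ℕ} {Ω : Type*} [MeasurableSpace Ω] {P : Measure Ω} {H : ℝ} {W : I → Ω → E d}

theorem IsFBM.memLp_two (hW : IsFBM P H W) (t : I) (i : Fin d) :
    MemLp (fun ω => W t ω i) 2 P :=
  ((hW.gaussian.hasGaussianLaw_eval t).map_fun (EuclideanSpace.proj i)).memLp_two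

theorem IsFBM.integral_coord (hW : IsFBM P H W) (t : I) (i : Fin d) :
    ∫ ω, W t ω i ∂P = 0 := by
  have h := (EuclideanSpace.proj (𝕜 := ℝ) i).integral_comp_comm
    (hW.gaussian.hasGaussianLaw_eval t).integrable
  rw [hW.mean t] at h
  simpa using h

theorem IsFBM.variance_coord (hW : IsFBM P H W) (hH : 0 < H) (t : I) (i : Fin d) :
    Var[fun ω => W t ω i; P] = (t : ℝ) ^ (2 * H) := by
  rw [← covariance_self (hW.memLp_two t i).aestronglyMeasurable.aemeasurable, hW.cov, if_pos rfl]
  simp [Real.zero_rpow (by positivity : 2 * H ≠ 0)]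

theorem IsFBM.variance_sub (hW : IsFBM P H W) (hH : 0 < H) (s t : I) (i : Fin d) :
    Var[fun ω => W t ω i - W s ω i; P] = |(t : ℝ) - s| ^ (2 * H) := by
  have := hW.gaussian.isProbabilityMeasure
  rw [variance_fun_sub (hW.memLp_two t i) (hW.memLp_two s i), hW.variance_coord hH,
    hW.variance_coord hH, hW.cov, if_pos rfl, abs_sub_comm (s : ℝ) t]
  ring

/-- The increments of the coordinates of a fractional Brownian motion are rescaled standard
Gaussian variables. -/
theorem IsFBM.map_sub (hW : IsFBM P H W) (hH : 0 < H) (s t : I) (i : Fin d) :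
    P.map (fun ω => W t ω i - W s ω i) =
      (gaussianReal 0 1).map (fun z => |(t : ℝ) - s| ^ H * z) := by
  have := hW.gaussian.isProbabilityMeasure
  have hg : HasGaussianLaw (fun ω => W t ω i - W s ω i) P :=
    (hW.gaussian.hasGaussianLaw_fun_sub (s := t) (t := s)).map_fun (EuclideanSpace.proj i)
  rw [hg.map_eq_gaussianReal, hW.variance_sub hH,
    integral_sub ((hW.memLp_two t i).integrable (by norm_num))
      ((hW.memLp_two s i).integrable (by norm_num)), hW.integral_coord, hW.integral_coord,
    gaussianReal_map_const_mul]
  congr 1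
  · simp
  · ext
    rw [Real.coe_toNNReal _ (by positivity)]
    simp [mul_comm 2 H, Real.rpow_mul (abs_nonneg _)]

theorem IsFBM.aemeasurable_sub (hW : IsFBM P H W) (s t : I) (i : Fin d) :
    AEMeasurable (fun ω => W t ω i - W s ω i) P :=
  (hW.memLp_two t i).aestronglyMeasurable.aemeasurable.sub
    (hW.memLp_two s i).aestronglyMeasurable.aemeasurable

/-- The absolute moments of the increments of a fractional Brownian motion. -/
theorem IsFBM.lintegral_enorm_sub_rpow (hW : IsFBM P H W) (hH : 0 < H) (s t : I) (i : Fin d)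
    {r : ℝ} (hr : 0 ≤ r) :
    ∫⁻ ω, ‖W t ω i - W s ω i‖ₑ ^ r ∂P =
      ENNReal.ofReal (|(t : ℝ) - s| ^ (H * r)) * ∫⁻ z, ‖z‖ₑ ^ r ∂(gaussianReal 0 1) := by
  have h1 : ∫⁻ ω, ‖W t ω i - W s ω i‖ₑ ^ r ∂P =
      ∫⁻ z, ‖z‖ₑ ^ r ∂(P.map (fun ω => W t ω i - W s ω i)) :=
    (lintegral_map' (f := fun z : ℝ => ‖z‖ₑ ^ r) (by fun_prop) (hW.aemeasurable_sub s t i)).symm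
  rw [h1, hW.map_sub hH, lintegral_map (by fun_prop) (by fun_prop),
    ← lintegral_const_mul _ (by fun_prop)]
  refine lintegral_congr fun z => ?_
  rw [enorm_mul, ENNReal.mul_rpow_of_nonneg _ _ hr, Real.rpow_mul (abs_nonneg _),
    ← ENNReal.ofReal_rpow_of_nonneg (by positivity) hr, Real.enorm_of_nonneg (by positivity)]

theorem lintegral_enorm_rpow_gaussianReal_lt_top {r : ℝ} (hr : 0 < r) :
    ∫⁻ z, ‖z‖ₑ ^ r ∂(gaussianReal 0 1) < ∞ := by
  have h := (memLp_id_gaussianReal' (μ := 0) (v := 1) (ENNReal.ofReal r) (by simp)).2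
  have := lintegral_rpow_enorm_lt_top_of_eLpNorm_lt_top (by simpa using hr) (by simp) h
  simpa [ENNReal.toReal_ofReal hr.le] using this

theorem lintegral_enorm_gaussianReal_pos : 0 < ∫⁻ z, ‖z‖ₑ ∂(gaussianReal 0 1) := by
  rw [pos_iff_ne_zero]
  intro h
  rw [lintegral_eq_zero_iff (by fun_prop)] at h
  have hv : Var[fun z => z; gaussianReal 0 1] = 0 := by
    rw [variance_congr (Y := fun _ => (0 : ℝ)) (by filter_upwards [h] with z hz; simpa using hz)]
    exact variance_zero _
  simp [variance_fun_id_gaussianReal] at hv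

theorem IsFBM.ae_zero (hW : IsFBM P H W) (hH : 0 < H) : ∀ᵐ ω ∂P, W 0 ω = 0 := by
  have hi : ∀ i : Fin d, ∀ᵐ ω ∂P, W 0 ω i = 0 := by
    intro i
    have := hW.gaussian.isProbabilityMeasure
    have h := hW.variance_coord hH 0 i
    rw [Set.Icc.coe_zero, Real.zero_rpow (by positivity),
      variance_eq_integral (hW.memLp_two 0 i).aestronglyMeasurable.aemeasurable,
      hW.integral_coord] at h
    have h2 := (integral_eq_zero_iff_of_nonneg (fun ω => sq_nonneg _)
      (by simpa using (hW.memLp_two 0 i).integrable_sq)).1 h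
    filter_upwards [h2] with ω hω
    simpa using hω
  filter_upwards [ae_all_iff.2 hi] with ω hω
  ext i
  simpa using hω i

end Increments

/-! ### Hölder continuity of the paths (Kolmogorov's criterion) -/

/-- A continuous function whose dyadic increments satisfy a Hölder bound is Hölder continuous. -/
theorem abs_sub_le_of_dyadic {F : ℝ → ℝ} (hF : Continuous F) {h K : ℝ} (hh : 0 < h) (hK : 0 ≤ K)
    (hd : ∀ n j : ℕ, j < 2 ^ n →
      |F ((j + 1) / 2 ^ n) - F (j / 2 ^ n)| ≤ K * ((2 : ℝ) ^ (-h)) ^ n)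
    {s t : ℝ} (hs : 0 ≤ s) (hst : s ≤ t) (ht : t ≤ 1) :
    |F t - F s| ≤ K * (1 + 2 / (1 - (2 : ℝ) ^ (-h))) * 2 ^ h * (t - s) ^ h := by
  set ρ : ℝ := (2 : ℝ) ^ (-h) with hρ
  have hρ0 : 0 < ρ := by positivity
  have hρ1 : ρ < 1 := Real.rpow_lt_one_of_one_lt_of_neg (by norm_num) (by linarith)
  rcases hst.eq_or_lt with rfl | hlt
  · simp [Real.zero_rpow hh.ne']
  have key : ∀ u : ℝ, 0 ≤ u → u ≤ 1 → ∀ n : ℕ,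
      |F u - F (⌊2 ^ n * u⌋₊ / 2 ^ n)| ≤ K * ρ ^ n / (1 - ρ) := by
    intro u hu0 hu1 n
    rw [abs_sub_comm, ← Real.dist_eq]
    refine dist_le_of_le_geometric_of_tendsto (f := fun n : ℕ => F (⌊2 ^ n * u⌋₊ / 2 ^ n)) ρ K hρ1
      ?_ ?_ n
    · intro m
      -- Going from level `m + 1` to level `m` halves the floor, so the two approximations of `u`
      -- coincide or differ by one dyadic step of level `m + 1`; the errors then sum geometrically.
      have e : ⌊(2 : ℝ) ^ m * u⌋₊ = ⌊(2 : ℝ) ^ (m + 1) * u⌋₊ / 2 := by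
        rw [← Nat.floor_div_natCast]
        congr 1
        push_cast
        ring
      have hle : ⌊(2 : ℝ) ^ (m + 1) * u⌋₊ ≤ 2 ^ (m + 1) := by
        have : (2 : ℝ) ^ (m + 1) * u ≤ ((2 ^ (m + 1) : ℕ) : ℝ) := by
          push_cast
          nlinarith [pow_pos (by norm_num : (0 : ℝ) < 2) (m + 1)]
        exact Nat.floor_le_of_le this
      generalize ⌊(2 : ℝ) ^ (m + 1) * u⌋₊ = N at e hle
      generalize ⌊(2 : ℝ) ^ m * u⌋₊ = M at e
      have hpos : (0 : ℝ) < 2 ^ m := by positivity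
      rcases Nat.even_or_odd' N with ⟨k, hk | hk⟩
      · have : M = k := by omega
        subst this
        have e2 : (N : ℝ) / 2 ^ (m + 1) = M / 2 ^ m := by
          rw [hk, pow_succ]; push_cast; field_simp
        rw [e2, dist_self]
        positivity
      · have : M = k := by omega
        subst this
        have e2 : (M : ℝ) / 2 ^ m = (2 * M : ℕ) / 2 ^ (m + 1) := by
          rw [pow_succ]; push_cast; field_simp
        have e3 : (N : ℝ) / 2 ^ (m + 1) = ((2 * M : ℕ) + 1) / 2 ^ (m + 1) := by
          rw [hk]; push_cast; ring
        rw [e2, e3, dist_comm, Real.dist_eq]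
        refine (hd (m + 1) (2 * M) (by omega)).trans ?_
        rw [pow_succ]
        nlinarith [mul_nonneg hK (pow_pos hρ0 m).le]
    · have h1 : Tendsto (fun n : ℕ => (2 : ℝ) ^ n) atTop atTop :=
        tendsto_pow_atTop_atTop_of_one_lt (by norm_num)
      have h2 := (tendsto_nat_floor_mul_div_atTop hu0).comp h1
      refine (hF.tendsto u).comp ?_
      refine h2.congr fun n => ?_
      simp [mul_comm]
  -- The scale with `2^(-(n+1)) < t - s ≤ 2^(-n)`: the level-`n` approximations of `s` and `t` are
  -- equal or adjacent.
  obtain ⟨n, hn1, hn2⟩ := exists_nat_pow_near_of_lt_one (x := t - s) (y := (1 / 2 : ℝ))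
    (by linarith) (by linarith) (by norm_num) (by norm_num)
  have hpos : (0 : ℝ) < 2 ^ n := by positivity
  have hmid : |F (⌊2 ^ n * t⌋₊ / 2 ^ n) - F (⌊2 ^ n * s⌋₊ / 2 ^ n)| ≤ K * ρ ^ n := by
    have hts : (2 : ℝ) ^ n * t ≤ 2 ^ n * s + 1 := by
      have : (2 : ℝ) ^ n * (t - s) ≤ 1 := by
        calc (2 : ℝ) ^ n * (t - s) ≤ 2 ^ n * (1 / 2) ^ n := by gcongr
          _ = 1 := by rw [← mul_pow]; norm_num
      linarith
    have hge : ⌊(2 : ℝ) ^ n * s⌋₊ ≤ ⌊(2 : ℝ) ^ n * t⌋₊ := Nat.floor_mono (by gcongr)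
    have hle : ⌊(2 : ℝ) ^ n * t⌋₊ ≤ ⌊(2 : ℝ) ^ n * s⌋₊ + 1 := by
      rw [← Nat.floor_add_one (by positivity)]
      exact Nat.floor_mono hts
    have hle2 : ⌊(2 : ℝ) ^ n * t⌋₊ ≤ 2 ^ n := by
      have : (2 : ℝ) ^ n * t ≤ ((2 ^ n : ℕ) : ℝ) := by
        push_cast
        nlinarith
      exact Nat.floor_le_of_le this
    generalize ⌊(2 : ℝ) ^ n * t⌋₊ = N at *
    generalize ⌊(2 : ℝ) ^ n * s⌋₊ = M at *
    rcases Nat.eq_or_lt_of_le hge with rfl | hlt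
    · rw [sub_self, abs_zero]
      positivity
    · have : N = M + 1 := by omega
      subst this
      have := hd n M (by omega)
      push_cast
      exact this
  have hρn : ρ ^ n ≤ 2 ^ h * (t - s) ^ h := by
    have e : ρ ^ n = ((1 / 2 : ℝ) ^ n) ^ h := by
      rw [hρ, ← Real.rpow_natCast, ← Real.rpow_natCast, ← Real.rpow_mul (by norm_num),
        ← Real.rpow_mul (by norm_num), one_div, Real.inv_rpow (by norm_num),
        ← Real.rpow_neg (by norm_num)]
      congr 1
      ring
    rw [e, ← Real.mul_rpow (by norm_num) (by linarith)]
    refine Real.rpow_le_rpow (by positivity) ?_ hh.le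
    rw [pow_succ] at hn1
    linarith
  have h1 := key t (by linarith) ht n
  have h2 := key s hs (by linarith) n
  have h3 : |F t - F s| ≤ K * ρ ^ n / (1 - ρ) + K * ρ ^ n + K * ρ ^ n / (1 - ρ) := by
    rw [abs_le] at *
    constructor <;> linarith [h1.1, h1.2, h2.1, h2.2, hmid.1, hmid.2]
  have h1ρ : 0 < 1 - ρ := by linarith
  calc |F t - F s| ≤ K * (1 + 2 / (1 - ρ)) * ρ ^ n := by
        refine h3.trans (le_of_eq ?_)
        field_simp
        ring
    _ ≤ K * (1 + 2 / (1 - ρ)) * (2 ^ h * (t - s) ^ h) := by gcongr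
    _ = _ := by ring

/-- The paths of a fractional Brownian motion are Hölder continuous of every order `h < H`. -/
theorem IsFBM.ae_holder_coord {d : ℕ} {Ω : Type*} [MeasurableSpace Ω] {P : Measure Ω} {H : ℝ}
    {W : I → Ω → E d} (hW : IsFBM P H W) {h : ℝ} (hh : 0 < h) (hhH : h < H) (i : Fin d) :
    ∀ᵐ ω ∂P, ∃ K : ℝ, 0 ≤ K ∧ ∀ s t : I, s ≤ t →
      |W t ω i - W s ω i| ≤ K * ((t : ℝ) - s) ^ h := by
  have hH : 0 < H := hh.trans hhH
  -- With this moment, level `n` of `Z` below has mean `2^n · 2^(hrn) · 2^(-Hrn) M = 2^(-n) M`,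
  -- which is summable.
  set r : ℝ := 2 / (H - h) with hr
  have hr0 : 0 < r := div_pos two_pos (by linarith)
  have hrH : r * (H - h) = 2 := div_mul_cancel₀ _ (by linarith)
  let π : ℝ → I := Set.projIcc 0 1 zero_le_one
  let D : ℕ → ℕ → Ω → ℝ := fun n j ω => W (π ((j + 1) / 2 ^ n)) ω i - W (π (j / 2 ^ n)) ω i
  let Z : Ω → ℝ≥0∞ := fun ω => ∑' n : ℕ, ∑ j ∈ Finset.range (2 ^ n),
    ENNReal.ofReal (2 ^ (h * r * n)) * ‖D n j ω‖ₑ ^ r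
  have hDm : ∀ n j, AEMeasurable (D n j) P := fun n j => hW.aemeasurable_sub _ _ i
  set M : ℝ≥0∞ := ∫⁻ z, ‖z‖ₑ ^ r ∂(gaussianReal 0 1) with hM
  have hMtop : M < ∞ := lintegral_enorm_rpow_gaussianReal_lt_top hr0
  have hDint : ∀ n j, j < 2 ^ n →
      ∫⁻ ω, ‖D n j ω‖ₑ ^ r ∂P = ENNReal.ofReal (2 ^ (-(H * r * n))) * M := by
    intro n j hj
    have hpos : (0 : ℝ) < 2 ^ n := by positivity
    have hj' : (j : ℝ) + 1 ≤ 2 ^ n := by exact_mod_cast hj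
    simp only [D]
    rw [hW.lintegral_enorm_sub_rpow hH _ _ i hr0.le]
    simp only [π]
    rw [Set.projIcc_of_mem zero_le_one (x := (j : ℝ) / 2 ^ n)
        ⟨by positivity, by rw [div_le_one hpos]; linarith⟩,
      Set.projIcc_of_mem zero_le_one (x := ((j : ℝ) + 1) / 2 ^ n)
        ⟨by positivity, by rw [div_le_one hpos]; linarith⟩]
    congr 2
    simp only
    rw [← sub_div, add_sub_cancel_left, abs_of_pos (by positivity), one_div, ← Real.rpow_natCast,
      ← Real.rpow_neg (by norm_num), ← Real.rpow_mul (by norm_num)]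
    congr 1
    ring
  have hZint : ∫⁻ ω, Z ω ∂P ≠ ∞ := by
    simp only [Z]
    rw [lintegral_tsum fun n => by fun_prop]
    have : ∀ n : ℕ, ∫⁻ ω, ∑ j ∈ Finset.range (2 ^ n),
        ENNReal.ofReal (2 ^ (h * r * n)) * ‖D n j ω‖ₑ ^ r ∂P = (2⁻¹ : ℝ≥0∞) ^ n * M := by
      intro n
      rw [lintegral_finsetSum' _ fun j _ => by fun_prop]
      rw [Finset.sum_congr rfl (g := fun _ => ENNReal.ofReal (2 ^ (h * r * n)) *
        (ENNReal.ofReal (2 ^ (-(H * r * n))) * M))]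
      · rw [Finset.sum_const, Finset.card_range, nsmul_eq_mul, ← mul_assoc, ← mul_assoc]
        congr 1
        rw [← ENNReal.ofReal_natCast, ← ENNReal.ofReal_mul (by positivity),
          ← ENNReal.ofReal_mul (by positivity), show (2⁻¹ : ℝ≥0∞) = ENNReal.ofReal (2⁻¹) by
            rw [ENNReal.ofReal_inv_of_pos two_pos]; simp,
          ← ENNReal.ofReal_pow (by norm_num)]
        congr 1
        push_cast
        rw [← Real.rpow_natCast, ← Real.rpow_add two_pos, ← Real.rpow_add two_pos,
          ← Real.rpow_natCast, Real.inv_rpow (by norm_num), ← Real.rpow_neg (by norm_num)]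
        congr 1
        linear_combination (-(n : ℝ)) * hrH
      · intro j hj
        rw [lintegral_const_mul'' _ (by fun_prop), hDint n j (Finset.mem_range.1 hj)]
    simp_rw [this]
    rw [ENNReal.tsum_mul_right, ENNReal.tsum_geometric]
    refine ENNReal.mul_ne_top ?_ hMtop.ne
    simp
  have hZae : ∀ᵐ ω ∂P, Z ω < ∞ := ae_lt_top' (by fun_prop) hZint
  filter_upwards [hZae, hW.continuous] with ω hω hc
  have hcont : Continuous fun u : ℝ => W (π u) ω i :=
    (EuclideanSpace.proj (𝕜 := ℝ) i).continuous.comp (hc.comp continuous_projIcc)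
  set K : ℝ := (Z ω).toReal ^ (1 / r) with hKdef
  have hK : 0 ≤ K := by positivity
  have hd : ∀ n j : ℕ, j < 2 ^ n → |W (π ((j + 1) / 2 ^ n)) ω i - W (π (j / 2 ^ n)) ω i|
      ≤ K * ((2 : ℝ) ^ (-h)) ^ n := by
    intro n j hj
    have h1 : ENNReal.ofReal (2 ^ (h * r * n)) * ‖D n j ω‖ₑ ^ r ≤ Z ω :=
      (Finset.single_le_sum (f := fun j => ENNReal.ofReal (2 ^ (h * r * n)) * ‖D n j ω‖ₑ ^ r)
        (fun _ _ => zero_le) (Finset.mem_range.2 hj)).trans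
        (ENNReal.le_tsum (f := fun n : ℕ => ∑ j ∈ Finset.range (2 ^ n),
          ENNReal.ofReal (2 ^ (h * r * n)) * ‖D n j ω‖ₑ ^ r) n)
    have h2 := ENNReal.toReal_mono hω.ne h1
    rw [ENNReal.toReal_mul, ENNReal.toReal_ofReal (by positivity), ← ENNReal.toReal_rpow,
      toReal_enorm, Real.norm_eq_abs] at h2
    have h3 := Real.rpow_le_rpow (by positivity) h2 (by positivity : 0 ≤ 1 / r)
    rw [Real.mul_rpow (by positivity) (by positivity), ← Real.rpow_mul (by positivity),
      ← Real.rpow_mul (by positivity), mul_one_div_cancel hr0.ne', Real.rpow_one,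
      show h * r * n * (1 / r) = h * n by field_simp] at h3
    have e : ((2 : ℝ) ^ (-h)) ^ n = (2 ^ (h * n))⁻¹ := by
      rw [← Real.rpow_natCast, ← Real.rpow_mul (by norm_num), ← Real.rpow_neg (by norm_num)]
      congr 1
      ring
    rw [e, ← div_eq_mul_inv, le_div_iff₀ (by positivity), mul_comm]
    exact h3
  have hρ1 : (2 : ℝ) ^ (-h) < 1 := Real.rpow_lt_one_of_one_lt_of_neg (by norm_num) (by linarith)
  have h1ρ : 0 < 1 - (2 : ℝ) ^ (-h) := by linarith
  refine ⟨K * (1 + 2 / (1 - (2 : ℝ) ^ (-h))) * 2 ^ h, by positivity, fun s t hst => ?_⟩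
  have := abs_sub_le_of_dyadic hcont hh hK hd s.2.1 (t := t) hst t.2.2
  simpa [π, Set.projIcc_val] using this

/-- A common Hölder constant for all coordinates. -/
theorem IsFBM.ae_holder {d : ℕ} {Ω : Type*} [MeasurableSpace Ω] {P : Measure Ω} {H : ℝ}
    {W : I → Ω → E d} (hW : IsFBM P H W) {h : ℝ} (hh : 0 < h) (hhH : h < H) :
    ∀ᵐ ω ∂P, ∃ K : ℝ, 0 < K ∧ ∀ s t : I, s ≤ t → ∀ i,
      |W t ω i - W s ω i| ≤ K * ((t : ℝ) - s) ^ h := by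
  filter_upwards [ae_all_iff.2 fun i => hW.ae_holder_coord hh hhH i] with ω hω
  choose K hK0 hK using hω
  refine ⟨1 + ∑ i, K i, by linarith [Finset.sum_nonneg fun i (_ : i ∈ Finset.univ) => hK0 i],
    fun s t hst i => (hK i s t hst).trans ?_⟩
  have h0 : (0 : ℝ) ≤ (t : ℝ) - s := sub_nonneg.2 hst
  have := Finset.single_le_sum (f := K) (fun i _ => hK0 i) (Finset.mem_univ i)
  gcongr
  linarith

/-! ### The attracting drift and the confinement of its solutions -/

/-- A drift pulling every coordinate towards zero, with a singularity of order `α` at the origin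
of `ℝ^d` and of order `β` at time zero. -/
def attractingDrift {d : ℕ} (α β : ℝ) (t : I) (y : E d) : E d :=
  if ‖y‖ ≤ 1 then (‖y‖ ^ (-α) * (t : ℝ) ^ (-β)) • WithLp.toLp 2 (fun i => -(y i / |y i|)) else 0

theorem attractingDrift_apply {d : ℕ} {α β : ℝ} {t : I} {y : E d} (hy : ‖y‖ ≤ 1) (i : Fin d) :
    attractingDrift α β t y i = -(‖y‖ ^ (-α) * (t : ℝ) ^ (-β)) * (y i / |y i|) := by
  simp [attractingDrift, hy]

theorem coord_sub_eq {d : ℕ} {g Y w : I → E d} (hint : Integrable g volume)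
    (heq : ∀ t, Y t = (∫ r in Set.Iic t, g r) + w t) {s u : I} (hsu : s ≤ u) (i : Fin d) :
    Y u i - Y s i = (∫ r in Set.Ioc s u, g r i) + (w u i - w s i) := by
  have h1 : (∫ r in Set.Iic u, g r) = (∫ r in Set.Iic s, g r) + ∫ r in Set.Ioc s u, g r := by
    rw [← Set.Iic_union_Ioc_eq_Iic hsu]
    exact setIntegral_union (Set.Iic_disjoint_Ioc le_rfl) measurableSet_Ioc
      hint.integrableOn hint.integrableOn
  have h2 : (∫ r in Set.Ioc s u, g r i) = (∫ r in Set.Ioc s u, g r) i :=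
    (EuclideanSpace.proj (𝕜 := ℝ) i).integral_comp_comm hint.integrableOn
  rw [h2, heq u, heq s, h1]
  simp only [PiLp.add_apply]
  ring

/-- Otherwise, summing over the coordinates, the `ℓ¹` norm would be smaller than the Euclidean norm.
That `y ≠ 0` ensures that an index exists. -/
theorem exists_norm_le_mul_abs {d : ℕ} {y : E d} (hy : y ≠ 0) : ∃ i, ‖y‖ ≤ d * |y i| := by
  by_contra! hcon
  have hd : 0 < d := by
    rcases Nat.eq_zero_or_pos d with rfl | hd
    · exact absurd (Subsingleton.elim y 0) hy
    · exact hd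
  have hne : (Finset.univ : Finset (Fin d)).Nonempty := ⟨⟨0, hd⟩, Finset.mem_univ _⟩
  have hd' : (0 : ℝ) < d := by exact_mod_cast hd
  have h1 : ∑ i, d * |y i| < ∑ _i : Fin d, ‖y‖ := Finset.sum_lt_sum_of_nonempty hne fun i _ => hcon i
  rw [← Finset.mul_sum, Finset.sum_const, Finset.card_univ, Fintype.card_fin, nsmul_eq_mul] at h1
  have h2 : ∑ i, |y i| < ‖y‖ := lt_of_mul_lt_mul_left h1 hd'.le
  have h3 : ‖y‖ ^ 2 = ∑ i, |y i| ^ 2 := by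
    rw [EuclideanSpace.norm_sq_eq]
    simp
  have h4 : ∑ i, |y i| ^ 2 ≤ (∑ i, |y i|) ^ 2 :=
    Finset.sum_sq_le_sq_sum_of_nonneg fun i _ => abs_nonneg _
  have h5 : (∑ i, |y i|) ^ 2 < ‖y‖ ^ 2 := by
    have := Finset.sum_nonneg fun i (_ : i ∈ Finset.univ) => abs_nonneg (y i)
    gcongr
  linarith

/-- Elimination of the excursion length `τ`: `h2` gives `τ^(1-h) ≤ K R^a T`, and inserting this into
the power `1-h` of `h1` leaves `R^(1-h)` bounded by a constant times `R^(ah) T^h`. As `ρ > 0`, this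
can be solved for `R`. -/
theorem rpow_bound {R τ D K T h ρ a : ℝ} (hR : 0 < R) (hτ : 0 < τ) (hD : 0 < D) (hK : 0 < K)
    (hT : 0 < T) (hh0 : 0 < h) (hh1 : h < 1) (hρ : ρ = 1 - h - a * h) (hρ0 : 0 < ρ)
    (h1 : R ≤ D * (K * τ ^ h)) (h2 : τ * (R ^ (-a) * T⁻¹) ≤ K * τ ^ h) :
    R ≤ ((D * K) ^ (1 - h) * K ^ h) ^ (1 / ρ) * T ^ (h / ρ) := by
  have h3 : τ ^ (1 - h) ≤ K * R ^ a * T := by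
    rw [Real.rpow_sub hτ, Real.rpow_one, div_le_iff₀ (by positivity)]
    rw [Real.rpow_neg hR.le] at h2
    have : τ * ((R ^ a)⁻¹ * T⁻¹) * (R ^ a * T) ≤ K * τ ^ h * (R ^ a * T) := by gcongr
    have e : τ * ((R ^ a)⁻¹ * T⁻¹) * (R ^ a * T) = τ := by field_simp
    rw [e] at this
    linarith
  have h4 : R ^ (1 - h) ≤ (D * K) ^ (1 - h) * (K ^ h * R ^ (a * h) * T ^ h) := by
    calc R ^ (1 - h) ≤ (D * (K * τ ^ h)) ^ (1 - h) := by gcongr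
      _ = (D * K) ^ (1 - h) * (τ ^ (1 - h)) ^ h := by
        rw [← mul_assoc, Real.mul_rpow (by positivity) (by positivity), ← Real.rpow_mul hτ.le,
          ← Real.rpow_mul hτ.le, mul_comm h]
      _ ≤ (D * K) ^ (1 - h) * (K * R ^ a * T) ^ h := by gcongr
      _ = _ := by
        rw [Real.mul_rpow (x := K * R ^ a) (by positivity) (by positivity),
          Real.mul_rpow (x := K) (by positivity) (by positivity), ← Real.rpow_mul hR.le]
  have h5 : R ^ ρ ≤ (D * K) ^ (1 - h) * K ^ h * T ^ h := by
    rw [hρ, Real.rpow_sub hR (1 - h), div_le_iff₀ (by positivity)]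
    linarith
  calc R = (R ^ ρ) ^ (1 / ρ) := by
        rw [← Real.rpow_mul hR.le, mul_one_div_cancel hρ0.ne', Real.rpow_one]
    _ ≤ ((D * K) ^ (1 - h) * K ^ h * T ^ h) ^ (1 / ρ) := by gcongr
    _ = _ := by
      rw [Real.mul_rpow (by positivity) (by positivity), ← Real.rpow_mul hT.le, mul_one_div]

/-- A path driven by the attracting drift and a Hölder continuous perturbation stays much closer
to the origin than the perturbation alone would. -/
theorem norm_le_of_attractingDrift {d : ℕ} {α β h K : ℝ} (hα : 0 < α) (hβ : 0 < β) (hh0 : 0 < h)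
    (hh1 : h < 1) (hK : 0 < K) (hρ : 0 < 1 - h - α * h) {Y w : I → E d} (hY : Continuous Y)
    (hY0 : Y 0 = 0) (hint : Integrable (fun r => attractingDrift α β r (Y r)) volume)
    (heq : ∀ t, Y t = (∫ r in Set.Iic t, attractingDrift α β r (Y r)) + w t)
    (hw : ∀ s t : I, s ≤ t → ∀ i, |w t i - w s i| ≤ K * ((t : ℝ) - s) ^ h)
    {t : I} (hsmall : ∀ r ≤ t, ‖Y r‖ ≤ 1) {r : I} (hr : r ≤ t) :
    ‖Y r‖ ≤ ((d * K) ^ (1 - h) * K ^ h) ^ (1 / (1 - h - α * h)) *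
      (t : ℝ) ^ (β * (h / (1 - h - α * h))) := by
  obtain ⟨u, hu, hmax⟩ := (isClosed_Iic (a := t)).isCompact.exists_isMaxOn Set.nonempty_Iic
    hY.norm.continuousOn
  have hmax' : ∀ r ≤ t, ‖Y r‖ ≤ ‖Y u‖ := fun r hr => hmax hr
  have ht0 : 0 ≤ (t : ℝ) := t.2.1
  refine (hmax' r hr).trans ?_
  rcases eq_or_ne (Y u) 0 with hu0 | hu0
  · rw [hu0, norm_zero]
    positivity
  have hR : 0 < ‖Y u‖ := norm_pos_iff.2 hu0
  have hupos : 0 < u := by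
    rw [pos_iff_ne_zero]
    rintro rfl
    exact hu0 hY0
  have htpos : 0 < (t : ℝ) := lt_of_lt_of_le (show (0 : ℝ) < u from hupos) hu
  obtain ⟨i, hi⟩ := exists_norm_le_mul_abs hu0
  have hui : Y u i ≠ 0 := by
    intro h0
    rw [h0, abs_zero, mul_zero] at hi
    linarith
  have hd : (0 : ℝ) < d := by
    have : d ≠ 0 := by rintro rfl; exact i.elim0
    positivity
  set sg : ℝ := Y u i / |Y u i| with hsg
  have hsgabs : |sg| = 1 := by
    rw [hsg, abs_div, abs_abs, div_self (abs_ne_zero.2 hui)]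
  have hsgu : sg * Y u i = |Y u i| := by
    rw [hsg, div_mul_eq_mul_div, ← abs_mul_abs_self, mul_div_assoc,
      div_self (abs_ne_zero.2 hui), mul_one]
  have hfc : Continuous fun r => sg * Y r i :=
    continuous_const.mul ((EuclideanSpace.proj (𝕜 := ℝ) i).continuous.comp hY)
  have hcl : IsClosed {r : I | r ≤ u ∧ sg * Y r i ≤ 0} :=
    isClosed_Iic.inter (isClosed_le hfc continuous_const)
  -- The last time before `u` at which coordinate `i` does not have the sign it has at `u`. On `(s,
  -- u]` the drift opposes this sign throughout.
  obtain ⟨s, ⟨hsu, hs0⟩, hsmax⟩ := hcl.isCompact.exists_isGreatest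
    ⟨0, hupos.le, by simp [hY0]⟩
  have hlt : s < u := by
    refine lt_of_le_of_ne hsu ?_
    rintro rfl
    rw [hsgu] at hs0
    exact hui (abs_nonpos_iff.1 hs0)
  have hpos : ∀ r, s < r → r ≤ u → 0 < sg * Y r i := fun r h1 h2 => by
    by_contra! h3
    exact absurd (hsmax ⟨h2, h3⟩) (not_le.2 h1)
  have hτ : 0 < (u : ℝ) - s := sub_pos.2 hlt
  have hinti : Integrable (fun r => attractingDrift α β r (Y r) i) volume :=
    (EuclideanSpace.proj (𝕜 := ℝ) i).integrable_comp hint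
  -- Both singular factors decrease, so on the excursion the pull is at least its value at the
  -- largest norm `‖Y u‖` and the latest time `t`.
  have hdrift : sg * ∫ r in Set.Ioc s u, attractingDrift α β r (Y r) i ≤
      -(((u : ℝ) - s) * (‖Y u‖ ^ (-α) * ((t : ℝ) ^ β)⁻¹)) := by
    rw [← integral_const_mul]
    have hc : ∫ _ in Set.Ioc s u, -(‖Y u‖ ^ (-α) * ((t : ℝ) ^ β)⁻¹) =
        -(((u : ℝ) - s) * (‖Y u‖ ^ (-α) * ((t : ℝ) ^ β)⁻¹)) := by
      rw [setIntegral_const, measureReal_def, unitInterval.volume_Ioc,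
        ENNReal.toReal_ofReal hτ.le, smul_eq_mul]
      ring
    rw [← hc]
    refine setIntegral_mono_on (hinti.integrableOn.const_mul sg) (integrableOn_const (by simp))
      measurableSet_Ioc fun r ⟨hr1, hr2⟩ => ?_
    have hrt : r ≤ t := hr2.trans hu
    have hrpos : 0 < (r : ℝ) := lt_of_le_of_lt s.2.1 hr1
    have hp := hpos r hr1 hr2
    have hYi : Y r i ≠ 0 := by
      intro h0
      simp [h0] at hp
    have hYr : 0 < ‖Y r‖ := norm_pos_iff.2 fun h0 => hYi (by simp [h0])
    have hsign : sg * (Y r i / |Y r i|) = 1 := by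
      have : |Y r i| = sg * Y r i := by
        rw [← abs_of_pos hp, abs_mul, hsgabs, one_mul]
      rw [this]
      field_simp [left_ne_zero_of_mul hp.ne']
    rw [attractingDrift_apply (hsmall r hrt)]
    have e : sg * (-(‖Y r‖ ^ (-α) * (r : ℝ) ^ (-β)) * (Y r i / |Y r i|)) =
        -(‖Y r‖ ^ (-α) * (r : ℝ) ^ (-β)) := by
      linear_combination (-(‖Y r‖ ^ (-α) * (r : ℝ) ^ (-β))) * hsign
    rw [e, neg_le_neg_iff, ← Real.rpow_neg ht0]
    have h1 : ‖Y u‖ ^ (-α) ≤ ‖Y r‖ ^ (-α) :=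
      Real.rpow_le_rpow_of_nonpos hYr (hmax' r hrt) (by linarith)
    have h2 : (t : ℝ) ^ (-β) ≤ (r : ℝ) ^ (-β) :=
      Real.rpow_le_rpow_of_nonpos hrpos hrt (by linarith)
    gcongr
  have hinc := coord_sub_eq hint heq hsu i
  have hwsg : sg * (w u i - w s i) ≤ K * ((u : ℝ) - s) ^ h := by
    refine (le_abs_self _).trans ?_
    rw [abs_mul, hsgabs, one_mul]
    exact hw s u hsu i
  -- Since `sg * Y s i ≤ 0`, the noise must supply the height reached and also compensate the pull;
  -- each of the two is thus at most `K (u - s)^h`.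
  have hmain : |Y u i| + ((u : ℝ) - s) * (‖Y u‖ ^ (-α) * ((t : ℝ) ^ β)⁻¹) ≤
      K * ((u : ℝ) - s) ^ h := by
    have : sg * Y u i - sg * Y s i = sg * (∫ r in Set.Ioc s u, attractingDrift α β r (Y r) i) +
        sg * (w u i - w s i) := by
      linear_combination sg * hinc
    linarith
  have hnn : 0 ≤ ((u : ℝ) - s) * (‖Y u‖ ^ (-α) * ((t : ℝ) ^ β)⁻¹) := by positivity
  have := rpow_bound (T := (t : ℝ) ^ β) hR hτ hd hK (by positivity) hh0 hh1 rfl hρ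
    (hi.trans (by gcongr; linarith)) (by linarith [abs_nonneg (Y u i)])
  rwa [← Real.rpow_mul ht0] at this

/-! ### Variation of the noise along shrinking grids -/

theorem sum_abs_sub_le {d : ℕ} {g Y w : I → E d} (hint : Integrable g volume)
    (heq : ∀ t, Y t = (∫ r in Set.Iic t, g r) + w t) {τ : ℕ → I} (hτ : Monotone τ) {R : ℝ}
    (i : Fin d) (m : ℕ) (hR : ∀ j ≤ m, ‖Y (τ j)‖ ≤ R) :
    ∑ j ∈ Finset.range m, |w (τ (j + 1)) i - w (τ j) i| ≤
      2 * m * R + ∫ r in Set.Iic (τ m), ‖g r‖ := by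
  induction m with
  | zero => simpa using integral_nonneg fun _ => norm_nonneg _
  | succ m ih =>
    have hle : τ m ≤ τ (m + 1) := hτ (Nat.le_succ m)
    have h1 : (∫ r in Set.Iic (τ (m + 1)), ‖g r‖) =
        (∫ r in Set.Iic (τ m), ‖g r‖) + ∫ r in Set.Ioc (τ m) (τ (m + 1)), ‖g r‖ := by
      rw [← Set.Iic_union_Ioc_eq_Iic hle]
      exact setIntegral_union (Set.Iic_disjoint_Ioc le_rfl) measurableSet_Ioc
        hint.norm.integrableOn hint.norm.integrableOn
    have h2 := coord_sub_eq hint heq hle i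
    have h3 : |∫ r in Set.Ioc (τ m) (τ (m + 1)), g r i| ≤
        ∫ r in Set.Ioc (τ m) (τ (m + 1)), ‖g r‖ := by
      refine abs_integral_le_integral_abs.trans (integral_mono ?_ hint.norm.integrableOn fun r => ?_)
      · exact ((EuclideanSpace.proj (𝕜 := ℝ) i).integrable_comp hint).abs.integrableOn
      · exact PiLp.norm_apply_le (g r) i
    have h4 : ∀ j ≤ m + 1, |Y (τ j) i| ≤ R := fun j hj =>
      (PiLp.norm_apply_le (Y (τ j)) i).trans (hR j hj)
    have h5 := h4 m (Nat.le_succ m)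
    have h6 := h4 (m + 1) le_rfl
    rw [Finset.sum_range_succ, h1]
    have := ih fun j hj => hR j (hj.trans (Nat.le_succ m))
    push_cast
    -- A noise increment is an increment of `Y`, at most `2R`, minus a drift integral; the latter
    -- add up over disjoint intervals.
    have h7 : |w (τ (m + 1)) i - w (τ m) i| ≤
        2 * R + ∫ r in Set.Ioc (τ m) (τ (m + 1)), ‖g r‖ := by
      rw [abs_le] at *
      constructor <;> linarith [h3.1, h3.2, h5.1, h5.2, h6.1, h6.2]
    linarith

/-- The points `j m^{-1/H}`, truncated at `1`. -/
def grid (H : ℝ) (m j : ℕ) : I := Set.projIcc 0 1 zero_le_one (j * (m : ℝ) ^ (-(1 / H)))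

theorem grid_mono (H : ℝ) (m : ℕ) : Monotone (grid H m) := fun j k hjk =>
  Set.monotone_projIcc _ (by gcongr)

/-- The truncation at `1` is inactive for `j ≤ m`, because `1/H ≥ 1`. -/
theorem coe_grid {H : ℝ} (hH0 : 0 < H) (hH1 : H < 1) {m j : ℕ} (hm : 0 < m) (hj : j ≤ m) :
    (grid H m j : ℝ) = j * (m : ℝ) ^ (-(1 / H)) := by
  have hm' : (1 : ℝ) ≤ m := by exact_mod_cast hm
  have hHinv : 1 ≤ 1 / H := by rw [le_div_iff₀ hH0]; linarith
  have hle : (j : ℝ) * (m : ℝ) ^ (-(1 / H)) ≤ 1 := by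
    calc (j : ℝ) * (m : ℝ) ^ (-(1 / H)) ≤ m * (m : ℝ) ^ (-1 : ℝ) := by gcongr
      _ = 1 := by rw [Real.rpow_neg_one, mul_inv_cancel₀ (by positivity)]
  rw [grid, Set.projIcc_of_mem zero_le_one ⟨by positivity, hle⟩]

theorem coe_grid_self {H : ℝ} (hH0 : 0 < H) (hH1 : H < 1) {m : ℕ} (hm : 0 < m) :
    (grid H m m : ℝ) = (m : ℝ) ^ (1 - 1 / H) := by
  have hm' : (0 : ℝ) < m := by exact_mod_cast hm
  rw [coe_grid hH0 hH1 hm le_rfl, sub_eq_add_neg, Real.rpow_add hm', Real.rpow_one]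

theorem tendsto_grid_self {H : ℝ} (hH0 : 0 < H) (hH1 : H < 1) :
    Tendsto (fun m => (grid H m m : ℝ)) atTop (𝓝 0) := by
  have hlt : 0 < 1 / H - 1 := by rw [sub_pos, lt_div_iff₀ hH0]; linarith
  have h := (tendsto_rpow_neg_atTop hlt).comp tendsto_natCast_atTop_atTop
  refine h.congr' ?_
  filter_upwards [eventually_gt_atTop 0] with m hm
  rw [coe_grid_self hH0 hH1 hm]
  simp

/-- Along the grids, the variation of a Hölder continuous perturbation that admits an integrable
solution for the attracting drift vanishes. -/
theorem tendsto_sum_abs_sub {d : ℕ} {α β h K H : ℝ} (hα : 0 < α) (hβ : 0 < β) (hh0 : 0 < h)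
    (hH0 : 0 < H) (hH1 : H < 1) (hh1 : h < H) (hK : 0 < K) (hρ : 0 < 1 - h - α * h)
    (hγ : H / (1 - H) < β * (h / (1 - h - α * h)))
    {Y w : I → E d} (hY : Continuous Y)
    (hY0 : Y 0 = 0) (hint : Integrable (fun r => attractingDrift α β r (Y r)) volume)
    (heq : ∀ t, Y t = (∫ r in Set.Iic t, attractingDrift α β r (Y r)) + w t)
    (hw : ∀ s t : I, s ≤ t → ∀ i, |w t i - w s i| ≤ K * ((t : ℝ) - s) ^ h) (i : Fin d) :
    Tendsto (fun m : ℕ => ∑ j ∈ Finset.range m, |w (grid H m (j + 1)) i - w (grid H m j) i|)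
      atTop (𝓝 0) := by
  set γ := β * (h / (1 - h - α * h)) with hγdef
  set C := ((d * K) ^ (1 - h) * K ^ h) ^ (1 / (1 - h - α * h)) with hC
  have hsmall : ∀ᶠ m in atTop, ∀ r ≤ grid H m m, ‖Y r‖ ≤ 1 := by
    have h1 : ∀ᶠ r in 𝓝 (0 : I), ‖Y r‖ ≤ 1 := by
      have : Tendsto (fun r => ‖Y r‖) (𝓝 0) (𝓝 0) := by
        simpa [hY0] using hY.norm.tendsto 0
      filter_upwards [this.eventually_lt_const one_pos] with r hr using hr.le
    obtain ⟨ε, hε, hball⟩ := Metric.eventually_nhds_iff.1 h1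
    filter_upwards [(tendsto_grid_self hH0 hH1).eventually_lt_const hε] with m hm r hr
    refine hball ?_
    rw [Subtype.dist_eq, Real.dist_eq, Set.Icc.coe_zero, sub_zero, abs_of_nonneg r.2.1]
    exact lt_of_le_of_lt hr hm
  have hbound : ∀ᶠ m : ℕ in atTop,
      ∑ j ∈ Finset.range m, |w (grid H m (j + 1)) i - w (grid H m j) i| ≤
        2 * C * (m : ℝ) ^ (1 + (1 - 1 / H) * γ) +
          ∫ r in Set.Iic (grid H m m), ‖attractingDrift α β r (Y r)‖ := by
    filter_upwards [hsmall, eventually_gt_atTop 0] with m hm hm0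
    have hm0' : (0 : ℝ) < m := by exact_mod_cast hm0
    have h1 := sum_abs_sub_le hint heq (grid_mono H m) i m fun j hj =>
      norm_le_of_attractingDrift hα hβ hh0 (hh1.trans hH1) hK hρ hY hY0 hint heq hw hm
        (grid_mono H m hj)
    refine h1.trans (le_of_eq ?_)
    rw [coe_grid_self hH0 hH1 hm0, ← Real.rpow_mul hm0'.le, Real.rpow_add hm0', Real.rpow_one]
    ring
  -- The exponent of `m · t_m^γ` is negative exactly when `γ > H/(1-H)`.
  have hexp : 0 < -(1 + (1 - 1 / H) * γ) := by
    have h1 : H < γ * (1 - H) := (div_lt_iff₀ (by linarith)).1 hγ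
    have h2 : -(1 + (1 - 1 / H) * γ) = (γ * (1 - H) - H) / H := by
      field_simp
      ring
    rw [h2]
    exact div_pos (by linarith) hH0
  have hlim : Tendsto (fun m : ℕ => 2 * C * (m : ℝ) ^ (1 + (1 - 1 / H) * γ) +
      ∫ r in Set.Iic (grid H m m), ‖attractingDrift α β r (Y r)‖) atTop (𝓝 0) := by
    have h1 := ((tendsto_rpow_neg_atTop hexp).comp tendsto_natCast_atTop_atTop).const_mul (2 * C)
    have h2 : Tendsto (fun m : ℕ => ∫ r in Set.Iic (grid H m m), ‖attractingDrift α β r (Y r)‖)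
        atTop (𝓝 0) := by
      refine hint.norm.tendsto_setIntegral_nhds_zero ?_
      have := ENNReal.tendsto_ofReal (tendsto_grid_self hH0 hH1)
      simpa [Function.comp_def] using this
    simpa [Function.comp_def] using h1.add h2
  exact squeeze_zero' (Eventually.of_forall fun m => Finset.sum_nonneg fun j _ => abs_nonneg _)
    hbound hlim

/-! ### The drift in the mixed Lebesgue space -/

theorem attractingDrift_eq_smul {d : ℕ} (α β : ℝ) (t : I) (y : E d) :
    attractingDrift α β t y = ((t : ℝ) ^ (-β)) • attractingDrift α β 1 y := by
  simp only [attractingDrift]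
  split_ifs
  · simp [smul_smul, mul_comm]
  · simp

theorem norm_attractingDrift_one_le {d : ℕ} (α β : ℝ) (y : E d) :
    ‖attractingDrift α β 1 y‖ ≤ d * ‖y‖ ^ (-α) := by
  have hrhs : 0 ≤ d * ‖y‖ ^ (-α) := by positivity
  rcases eq_or_ne (attractingDrift α β 1 y) 0 with h0 | h0
  · simpa [h0] using hrhs
  have hy : ‖y‖ ≤ 1 := by
    by_contra hcon
    simp [attractingDrift, hcon] at h0
  obtain ⟨i, hi⟩ := exists_norm_le_mul_abs h0
  refine hi.trans ?_
  gcongr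
  rw [attractingDrift_apply hy, abs_mul, abs_neg, Set.Icc.coe_one, Real.one_rpow, mul_one,
    abs_of_nonneg (by positivity : 0 ≤ ‖y‖ ^ (-α))]
  refine mul_le_of_le_one_right (by positivity) ?_
  rw [abs_div, abs_abs]
  exact div_self_le_one _

theorem measurable_attractingDrift {d : ℕ} {γ : Type*} [MeasurableSpace γ] (α β : ℝ)
    {f : γ → I} {g : γ → E d} (hf : Measurable f) (hg : Measurable g) :
    Measurable fun z => attractingDrift α β (f z) (g z) := by
  unfold attractingDrift
  refine Measurable.ite (measurableSet_le hg.norm measurable_const) ?_ measurable_const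
  have h1 : Measurable fun z => (fun i => -(g z i / |g z i|) : Fin d → ℝ) := by
    refine measurable_pi_lambda _ fun i => ?_
    have : Measurable fun z => g z i := by fun_prop
    exact (this.div (continuous_abs.measurable.comp this)).neg
  have h2 : Measurable fun z => ‖g z‖ ^ (-α) * (f z : ℝ) ^ (-β) := by fun_prop
  exact h2.smul ((WithLp.measurable_toLp 2 _).comp h1)

theorem memLp_attractingDrift_one {d : ℕ} (hd : 1 ≤ d) {α β p : ℝ} (hp : 1 ≤ p)
    (hα : α < d / p) :
    MemLp (attractingDrift (d := d) α β 1) (ENNReal.ofReal p) volume := by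
  have hp0 : 0 < p := by linarith
  have hm : Measurable (attractingDrift (d := d) α β 1) :=
    measurable_attractingDrift α β measurable_const measurable_id
  rw [← integrable_norm_rpow_iff hm.aestronglyMeasurable (by simpa using hp0) (by simp),
    ENNReal.toReal_ofReal hp0.le]
  -- The singularity is integrable since `αp < d`; radius `2` makes the open ball contain the closed
  -- unit ball supporting the drift.
  have hball : IntegrableOn (fun y : E d => ‖attractingDrift α β 1 y‖ ^ p) (Metric.ball 0 2)
      volume := by
    refine integrableOn_ball_of_norm_le_rpow (C := (d : ℝ) ^ p) (α := α * p) (by simpa using hd)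
      (by simpa using (lt_div_iff₀ hp0).1 hα) (Eventually.of_forall fun y => ?_)
      (hm.norm.pow_const p).aestronglyMeasurable
    rw [Real.norm_of_nonneg (by positivity)]
    calc ‖attractingDrift α β 1 y‖ ^ p ≤ (d * ‖y‖ ^ (-α)) ^ p := by
          gcongr
          exact norm_attractingDrift_one_le α β y
      _ = _ := by
          rw [Real.mul_rpow (by positivity) (by positivity), ← Real.rpow_mul (norm_nonneg _),
            neg_mul]
  refine (integrableOn_iff_integrable_of_support_subset fun y hy => ?_).1 hball
  by_contra hcon
  have : ¬ ‖y‖ ≤ 1 := by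
    rw [mem_ball_zero_iff] at hcon
    linarith
  simp [attractingDrift, this, Real.zero_rpow hp0.ne'] at hy

theorem memLp_rpow_neg {β q : ℝ} (hq : 1 ≤ q) (hβ : β < 1 / q) :
    MemLp (fun t : I => (t : ℝ) ^ (-β)) (ENNReal.ofReal q) volume := by
  have hq0 : 0 < q := by linarith
  have hm : Measurable fun t : I => (t : ℝ) ^ (-β) := by fun_prop
  rw [← integrable_norm_rpow_iff hm.aestronglyMeasurable (by simpa using hq0) (by simp),
    ENNReal.toReal_ofReal hq0.le]
  have h1 : -1 < -(β * q) := by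
    have := (lt_div_iff₀ hq0).1 hβ
    linarith
  have h2 := (intervalIntegral.intervalIntegrable_rpow' (a := 0) (b := 1) h1)
  rw [intervalIntegrable_iff_integrableOn_Icc_of_le zero_le_one] at h2
  have h3 := (unitInterval.measurePreserving_coe.integrable_comp_emb
    unitInterval.measurableEmbedding_coe (g := fun t : ℝ => t ^ (-(β * q)))).2 h2
  refine h3.congr (Eventually.of_forall fun t => ?_)
  have ht : 0 ≤ (t : ℝ) := t.2.1
  simp only [Function.comp_apply]
  rw [Real.norm_of_nonneg (by positivity), ← Real.rpow_mul ht, neg_mul]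

/-- The attracting drift centered at `x` belongs to the mixed Lebesgue space. -/
theorem memMixedLp_attractingDrift {d : ℕ} (hd : 1 ≤ d) {α β p q : ℝ} (hp : 1 ≤ p) (hq : 1 ≤ q)
    (hα : α < d / p) (hβ : β < 1 / q) (x : E d) :
    MemMixedLp q p fun t y => attractingDrift α β t (y - x) := by
  refine ⟨?_, ?_⟩
  · exact measurable_attractingDrift α β measurable_fst (measurable_snd.sub_const x)
  have hN := memLp_attractingDrift_one (β := β) hd hp hα
  set N := eLpNorm (attractingDrift (d := d) α β 1) (ENNReal.ofReal p) volume with hNdef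
  have hin : ∀ t : I, eLpNorm (fun y => attractingDrift α β t (y - x)) (ENNReal.ofReal p) volume =
      ‖N.toReal * (t : ℝ) ^ (-β)‖ₑ := by
    intro t
    have h1 : (fun y => attractingDrift α β t (y - x)) =
        (((t : ℝ) ^ (-β)) • attractingDrift (d := d) α β 1) ∘ (fun y => y - x) := by
      ext1 y
      exact attractingDrift_eq_smul α β t (y - x)
    rw [h1, eLpNorm_comp_measurePreserving (hN.1.const_smul _) (measurePreserving_sub_right _ x),
      eLpNorm_const_smul, ← hNdef, enorm_mul, mul_comm, Real.enorm_of_nonneg ENNReal.toReal_nonneg,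
      ENNReal.ofReal_toReal hN.2.ne]
  simp_rw [hin]
  rw [eLpNorm_enorm]
  exact ((memLp_rpow_neg hq hβ).const_mul N.toReal).2

/-! ### Non-vanishing variation of fractional Brownian motion -/

theorem le_min_add_sq_div (a : ℝ≥0∞) {L : ℝ≥0∞} (hL : L ≠ 0) (hL' : L ≠ ∞) :
    a ≤ min a L + a ^ (2 : ℝ) / L := by
  rcases le_total a L with h | h
  · rw [min_eq_left h]
    exact le_self_add
  · refine le_add_left ?_
    rw [ENNReal.le_div_iff_mul_le (Or.inl hL) (Or.inl hL'), ENNReal.rpow_two, sq]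
    gcongr

/-- The variation of a fractional Brownian motion along the grids does not vanish. -/
theorem IsFBM.not_ae_tendsto_sum_abs_sub {d : ℕ} {Ω : Type*} [MeasurableSpace Ω] {P : Measure Ω}
    {H : ℝ} {W : I → Ω → E d} (hW : IsFBM P H W) (hH0 : 0 < H) (hH1 : H < 1) (i : Fin d) :
    ¬ ∀ᵐ ω ∂P, Tendsto (fun m : ℕ => ∑ j ∈ Finset.range m,
      |W (grid H m (j + 1)) ω i - W (grid H m j) ω i|) atTop (𝓝 0) := by
  intro hlim
  have := hW.gaussian.isProbabilityMeasure
  let D : ℕ → ℕ → Ω → ℝ := fun m j ω => W (grid H m (j + 1)) ω i - W (grid H m j) ω i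
  let T : ℕ → Ω → ℝ≥0∞ := fun m ω => ∑ j ∈ Finset.range m, ‖D m j ω‖ₑ
  have hDm : ∀ m j, AEMeasurable (D m j) P := fun m j => hW.aemeasurable_sub _ _ i
  have hTm : ∀ m, AEMeasurable (T m) P := fun m => by fun_prop
  have hTlim : ∀ᵐ ω ∂P, Tendsto (fun m => T m ω) atTop (𝓝 0) := by
    filter_upwards [hlim] with ω hω
    have := ENNReal.tendsto_ofReal hω
    rw [ENNReal.ofReal_zero] at this
    refine this.congr fun m => ?_
    rw [ENNReal.ofReal_sum_of_nonneg fun j _ => abs_nonneg _]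
    exact Finset.sum_congr rfl fun j _ => (Real.enorm_eq_ofReal_abs _).symm
  have hD : ∀ m j, j < m → ∀ r : ℝ, 0 ≤ r → ∫⁻ ω, ‖D m j ω‖ₑ ^ r ∂P =
      (m : ℝ≥0∞) ^ (-r) * ∫⁻ z, ‖z‖ₑ ^ r ∂(gaussianReal 0 1) := by
    intro m j hj r hr
    have hm : 0 < m := by omega
    have hm' : (0 : ℝ) < m := by exact_mod_cast hm
    simp only [D]
    rw [hW.lintegral_enorm_sub_rpow hH0 _ _ i hr, coe_grid hH0 hH1 hm hj,
      coe_grid hH0 hH1 hm hj.le]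
    congr 1
    have e : ((j + 1 : ℕ) : ℝ) * (m : ℝ) ^ (-(1 / H)) - j * (m : ℝ) ^ (-(1 / H)) =
        (m : ℝ) ^ (-(1 / H)) := by
      push_cast
      ring
    rw [e, abs_of_pos (by positivity), ← Real.rpow_mul hm'.le,
      ← ENNReal.ofReal_natCast, ENNReal.ofReal_rpow_of_pos hm']
    congr 2
    field_simp
  set M₁ : ℝ≥0∞ := ∫⁻ z, ‖z‖ₑ ∂(gaussianReal 0 1) with hM₁
  set M₂ : ℝ≥0∞ := ∫⁻ z, ‖z‖ₑ ^ (2 : ℝ) ∂(gaussianReal 0 1) with hM₂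
  have hfirst : ∀ m, 0 < m → ∫⁻ ω, T m ω ∂P = M₁ := by
    intro m hm
    simp only [T]
    rw [lintegral_finsetSum' _ fun j _ => by fun_prop,
      Finset.sum_congr rfl (g := fun _ => (m : ℝ≥0∞)⁻¹ * M₁)]
    · rw [Finset.sum_const, Finset.card_range, nsmul_eq_mul, ← mul_assoc,
        ENNReal.mul_inv_cancel (by simpa using hm.ne') (by simp), one_mul]
    · intro j hj
      have := hD m j (Finset.mem_range.1 hj) 1 zero_le_one
      simpa [ENNReal.rpow_neg_one] using this
  -- Cauchy–Schwarz on the sum suffices: no decorrelation of the increments is needed.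
  have hsecond : ∀ m, 0 < m → ∫⁻ ω, T m ω ^ (2 : ℝ) ∂P ≤ M₂ := by
    intro m hm
    have hm0 : (m : ℝ≥0∞) ≠ 0 := by simpa using hm.ne'
    calc ∫⁻ ω, T m ω ^ (2 : ℝ) ∂P
        ≤ ∫⁻ ω, (m : ℝ≥0∞) * ∑ j ∈ Finset.range m, ‖D m j ω‖ₑ ^ (2 : ℝ) ∂P := by
          refine lintegral_mono fun ω => ?_
          have := ENNReal.rpow_sum_le_const_mul_sum_rpow (Finset.range m)
            (fun j => ‖D m j ω‖ₑ) (p := 2) (by norm_num)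
          rw [show (2 : ℝ) - 1 = 1 by norm_num, ENNReal.rpow_one, Finset.card_range] at this
          exact this
      _ = m * ∑ j ∈ Finset.range m, ((m : ℝ≥0∞) ^ (-2 : ℝ) * M₂) := by
          rw [lintegral_const_mul'' _ (by fun_prop),
            lintegral_finsetSum' _ fun j _ => by fun_prop]
          congr 1
          exact Finset.sum_congr rfl fun j hj =>
            hD m j (Finset.mem_range.1 hj) 2 (by norm_num)
      _ = M₂ := by
          rw [Finset.sum_const, Finset.card_range, nsmul_eq_mul, ← mul_assoc, ← mul_assoc,
            ENNReal.rpow_neg, ENNReal.rpow_two, sq, ENNReal.mul_inv_cancel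
            (mul_ne_zero hm0 hm0) (by simp [ENNReal.mul_eq_top]), one_mul]
  -- Uniform integrability by hand: the mean truncated at `n` tends to zero by dominated
  -- convergence, while the second moment bounds the excess by `M₂ / n` uniformly in `m`.
  have hle : ∀ n : ℕ, 0 < n → M₁ ≤ M₂ / n := by
    intro n hn
    have hn0 : (n : ℝ≥0∞) ≠ 0 := by simpa using hn.ne'
    have htr : Tendsto (fun m => ∫⁻ ω, min (T m ω) n ∂P) atTop (𝓝 0) := by
      have := tendsto_lintegral_of_dominated_convergence' (μ := P)
        (F := fun m ω => min (T m ω) n) (f := fun _ => 0) (fun _ => (n : ℝ≥0∞))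
        (fun m => (hTm m).min aemeasurable_const)
        (fun m => Eventually.of_forall fun ω => min_le_right _ _) (by simp)
        (by
          filter_upwards [hTlim] with ω hω
          simpa using hω.min (tendsto_const_nhds (x := (n : ℝ≥0∞))))
      simpa using this
    have hb : ∀ᶠ m in atTop, M₁ ≤ (∫⁻ ω, min (T m ω) n ∂P) + M₂ / n := by
      filter_upwards [eventually_gt_atTop 0] with m hm
      rw [← hfirst m hm]
      calc ∫⁻ ω, T m ω ∂P ≤ ∫⁻ ω, (min (T m ω) n + T m ω ^ (2 : ℝ) / n) ∂P :=
            lintegral_mono fun ω => le_min_add_sq_div _ hn0 (by simp)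
        _ = (∫⁻ ω, min (T m ω) n ∂P) + (∫⁻ ω, T m ω ^ (2 : ℝ) ∂P) / n := by
            rw [lintegral_add_left' ((hTm m).min aemeasurable_const)]
            simp_rw [div_eq_mul_inv]
            rw [lintegral_mul_const'' _ ((hTm m).pow_const _)]
        _ ≤ _ := by
            gcongr
            exact hsecond m hm
    have := ge_of_tendsto (htr.add_const (M₂ / n)) hb
    simpa using this
  have hM₂top : M₂ ≠ ∞ := (lintegral_enorm_rpow_gaussianReal_lt_top two_pos).ne
  have hz : Tendsto (fun n : ℕ => M₂ / n) atTop (𝓝 0) := by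
    have := ENNReal.Tendsto.const_mul (a := M₂) ENNReal.tendsto_inv_nat_nhds_zero (Or.inr hM₂top)
    simpa [div_eq_mul_inv] using this
  have h0 : M₁ ≤ 0 := ge_of_tendsto hz (by
    filter_upwards [eventually_gt_atTop 0] with n hn using hle n hn)
  exact absurd lintegral_enorm_gaussianReal_pos (not_lt.2 h0)

/-! ### Choice of exponents and conclusion -/

theorem exists_exponents {H A B : ℝ} (hH0 : 0 < H) (hH1 : H < 1) (hA : 0 < A) (hB : 0 < B)
    (hAB : 1 - H < (1 - H) * B + H * A) :
    ∃ α β h : ℝ, 0 < α ∧ α < A ∧ 0 < β ∧ β < B ∧ 0 < h ∧ h < H ∧ 0 < 1 - h - α * h ∧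
      H / (1 - H) < β * (h / (1 - h - α * h)) := by
  have hH : 0 < 1 - H := by linarith
  -- Capping `A` keeps `αH < 1 - H`, hence `1 - h - αh > 0`, without losing the strict inequality.
  -- Scaling `A'` and `B` by a common `l < 1` then makes the bounds on `α` and `β` strict.
  set A' := min A ((1 - H) / H) with hA'
  have hA'0 : 0 < A' := lt_min hA (by positivity)
  have hA'H : H * A' ≤ 1 - H := by
    have := (le_div_iff₀ hH0).1 (min_le_right A ((1 - H) / H))
    linarith
  set S := (1 - H) * B + H * A' with hS
  have hS1 : 1 - H < S := by
    rcases min_choice A ((1 - H) / H) with h | h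
    · rw [hS, hA', h]; exact hAB
    · have e : H * A' = 1 - H := by rw [hA', h]; field_simp
      have : 0 < (1 - H) * B := by positivity
      linarith
  have hS0 : 0 < S := by linarith
  obtain ⟨l, hl1, hl2⟩ := exists_between ((div_lt_one hS0).2 hS1)
  have hl0 : 0 < l := lt_trans (by positivity) hl1
  have hlS : 1 - H < l * S := (div_lt_iff₀ hS0).1 hl1
  set α := l * A' with hα
  set β := l * B with hβ
  have hα0 : 0 < α := by positivity
  have hβ0 : 0 < β := by positivity
  have hαA : α < A := lt_of_lt_of_le (mul_lt_of_lt_one_left hA'0 hl2) (min_le_left _ _)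
  have hβB : β < B := mul_lt_of_lt_one_left hB hl2
  have hαH : H * α < 1 - H := by
    have : H * α = l * (H * A') := by rw [hα]; ring
    have h2 : l * (H * A') < H * A' := mul_lt_of_lt_one_left (by positivity) hl2
    linarith
  have hmain : 1 - H < β * (1 - H) + H * α := by
    have : β * (1 - H) + H * α = l * S := by rw [hα, hβ, hS]; ring
    linarith
  -- Cleared of denominators, the last inequality reads `H < h G`; it holds at `h = H` because `G >
  -- 1`, hence also for some `h < H`.
  set G := β * (1 - H) + H + α * H with hG
  have hG1 : 1 < G := by rw [hG]; linarith
  obtain ⟨h, hh1, hh2⟩ := exists_between (show H / G < H from div_lt_self hH0 hG1)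
  have hh0 : 0 < h := lt_trans (by positivity) hh1
  have hhG : H < h * G := (div_lt_iff₀ (by linarith)).1 hh1
  have hρ : 0 < 1 - h - α * h := by
    have : α * h ≤ α * H := by gcongr
    linarith
  refine ⟨α, β, h, hα0, hαA, hβ0, hβB, hh0, hh2, hρ, ?_⟩
  rw [← mul_div_assoc, div_lt_div_iff₀ hH hρ]
  rw [hG] at hhG
  linarith

/-- The equation with the attracting drift centered at the initial point has no weak solution. -/
theorem not_hasWeakSolution_attractingDrift {d : ℕ} (hd : 1 ≤ d) {α β h H : ℝ} (hα : 0 < α)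
    (hβ : 0 < β) (hh0 : 0 < h) (hH0 : 0 < H) (hH1 : H < 1) (hh1 : h < H)
    (hρ : 0 < 1 - h - α * h) (hγ : H / (1 - H) < β * (h / (1 - h - α * h))) (x : E d) :
    ¬ HasWeakSolution.{u} H x fun t y => attractingDrift α β t (y - x) := by
  rintro ⟨Ω, m, P, F, X, W, hsol⟩
  have hW : IsFBM P H W := hsol.fbm.1
  refine hW.not_ae_tendsto_sum_abs_sub hH0 hH1 ⟨0, hd⟩ ?_
  filter_upwards [hsol.continuous, hsol.equation, hW.ae_zero hH0, hW.ae_holder hh0 hh1]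
    with ω hc ⟨hint, heq⟩ hW0 ⟨K, hK, hKh⟩
  have heq' : ∀ t, X t ω - x =
      (∫ r in Set.Iic t, attractingDrift α β r (X r ω - x)) + W t ω := fun t => by
    rw [heq t]
    abel
  have hY0 : X 0 ω - x = 0 := by
    rw [heq' 0, hW0, add_zero]
    refine setIntegral_measure_zero _ ?_
    simp
  exact tendsto_sum_abs_sub hα hβ hh0 hH0 hH1 hh1 hK hρ hγ (Y := fun t => X t ω - x)
    (w := fun t => W t ω) (hc.sub continuous_const) hY0 hint heq' hKh ⟨0, hd⟩

end FractionalSDE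

end

theorem theorem2p2 (d : ℕ) (H p q : ℝ) (hH0 : 0 < H) (hH1 : H < 1) (hp : 1 ≤ p) (hq : 1 ≤ q)
    (hpq : (1 - H) / q + H * d / p > 1 - H) (x : FractionalSDE.E d) :
    ∃ b : unitInterval → FractionalSDE.E d → FractionalSDE.E d,
      FractionalSDE.MemMixedLp q p b ∧ ¬ FractionalSDE.HasWeakSolution.{u} H x b := by
  -- For `d = 0` the hypothesis would read `(1 - H)/q > 1 - H`, impossible for `q ≥ 1`.
  have hd : 1 ≤ d := by
    by_contra hcon
    obtain rfl : d = 0 := by omega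
    have : (1 - H) / q ≤ 1 - H := div_le_self (by linarith) hq
    simp at hpq
    linarith
  have hd' : (0 : ℝ) < d := by exact_mod_cast hd
  obtain ⟨α, β, h, hα, hαA, hβ, hβB, hh0, hhH, hρ, hγ⟩ :=
    FractionalSDE.exists_exponents (A := d / p) (B := 1 / q) hH0 hH1 (by positivity)
      (by positivity) (by
        rw [mul_one_div, ← mul_div_assoc]
        exact hpq)
  exact ⟨_, FractionalSDE.memMixedLp_attractingDrift hd hp hq hαA hβB x,
    FractionalSDE.not_hasWeakSolution_attractingDrift hd hα hβ hh0 hH0 hH1 hhH hρ hγ x⟩
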